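/- Let $(X,\mu)$ be a finite measure space. Let $K:\mathbb R\times X\to[0,+\infty)$ be integrable on $\mathbb R\times X$ with $\int_{\mathbb R}K(s,\tau)\,ds>0$ for all $\tau\in X$. Let $g:[0,+\infty)\times X\to[0,+\infty)$ be measurable with $g(0,\tau)=0$ for all $\tau\in X$, and suppose that for every fixed $\tau\in X$ the function $g(\cdot,\tau)$ is continuous and has a one-sided derivative $g'(0,\tau)\in(0,+\infty)$ at $0$. Consider the convolution equation $$\phi(t)=\int_X d\mu(\tau)\int_{\mathbb R}K(s,\tau)\,g(\phi(t-s),\tau)\,ds,\qquad t\in\mathbb R, \qquad (*)$$ and put $$\chi(z):=1-\int_X\int_{\mathbb R}K(s,\tau)\,g'(0,\tau)\,e^{-sz}\,ds\,d\mu(\tau).$$ Here a solution of $(*)$ is a Lebesgue measurable function $\phi:\mathbb R\to[0,+\infty)$ for which the integral in $(*)$ converges and the equality holds for every $t\in\mathbb R$. Assume that $\chi(0)<0$ and that the following two conditions hold. (C) For each $\delta>0$ there is a measurable function $C_\delta:X\to[0,+\infty)$ such that $g(u,\tau)\le C_\delta(\tau)u$ for all $u\in[0,\delta]$, $\tau\in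 X$, and $\int_X C_\delta(\tau)\,d\mu(\tau)\int_{\mathbb R}K(s,\tau)\,ds<+\infty$. (P) If a bounded solution $\phi\ge 0$ of $(*)$ vanishes at some point, then $\phi\equiv 0$. Then the following dichotomy holds for each bounded solution $\phi\ge0$ of $(*)$: either $\liminf_{t\to+\infty}\phi(t)>0$ or $\lim_{t\to+\infty}\phi(t)=0$. Likewise, either $\liminf_{t\to-\infty}\phi(t)>0$ or $\lim_{t\to-\infty}\phi(t)=0$. In both cases exactly one of the two alternatives holds. -/

import Mathlib

open Set Filter Topology MeasureTheory

noncomputable section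

namespace ConvolutionDichotomy

variable {X : Type*} [MeasurableSpace X]

/-- The standing assumptions on the kernel `K : ℝ × X → ℝ₊` and on the nonlinearity
`g : ℝ₊ × X → ℝ₊`. Only the values `g u τ` with `u ≥ 0` are ever relevant. -/
structure StandingAssumptions (μ : Measure X) (K g : ℝ → X → ℝ) : Prop where
  kernel_nonneg : ∀ s τ, 0 ≤ K s τ
  kernel_integrable : Integrable (fun p : ℝ × X => K p.1 p.2) (volume.prod μ)
  kernel_mass_pos : ∀ τ, 0 < ∫⁻ s, ENNReal.ofReal (K s τ)
  g_nonneg : ∀ u, 0 ≤ u → ∀ τ, 0 ≤ g u τ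
  g_measurable : Measurable (fun p : Ici (0 : ℝ) × X => g p.1 p.2)
  g_zero : ∀ τ, g 0 τ = 0
  g_continuous : ∀ τ, ContinuousOn (fun u => g u τ) (Ici 0)
  g_differentiable : ∀ τ, DifferentiableWithinAt ℝ (fun u => g u τ) (Ici 0) 0
  g_deriv_pos : ∀ τ, 0 < derivWithin (fun u => g u τ) (Ici 0) 0

/-- A bounded solution `φ ≥ 0` of
`φ(t) = ∫_X dμ(τ) ∫_ℝ K(s,τ) g(φ(t-s),τ) ds`, `t ∈ ℝ`;
the function is Lebesgue measurable and the integral converges for every `t`. -/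
structure IsBoundedSolution (μ : Measure X) (K g : ℝ → X → ℝ) (φ : ℝ → ℝ) : Prop where
  measurable : AEMeasurable φ volume
  nonneg : ∀ t, 0 ≤ φ t
  bounded : ∃ M, ∀ t, φ t ≤ M
  integrable : ∀ t,
    Integrable (fun p : ℝ × X => K p.1 p.2 * g (φ (t - p.1)) p.2) (volume.prod μ)
  equation : ∀ t, φ t = ∫ τ, (∫ s, K s τ * g (φ (t - s)) τ) ∂μ

/-- The characteristic function
`χ(z) = 1 - ∫_X ∫_ℝ K(s,τ) g'(0,τ) e^{-sz} ds dμ(τ)` at real `z`, where `g'(0,τ)` is the one-sided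
derivative. The integrand is nonnegative; the value is `-∞` when the integral diverges. -/
def chi (μ : Measure X) (K g : ℝ → X → ℝ) (z : ℝ) : EReal :=
  1 - ((∫⁻ τ, (∫⁻ s, ENNReal.ofReal
    (K s τ * derivWithin (fun u => g u τ) (Ici 0) 0 * Real.exp (-(s * z)))) ∂μ : ENNReal) : EReal)

/-- Condition (C): for each `δ > 0` there is a measurable `C_δ ≥ 0` with `g(u,τ) ≤ C_δ(τ) u` for
`u ∈ [0,δ]` and `∫_X C_δ(τ) dμ(τ) ∫_ℝ K(s,τ) ds < ∞`. -/
def ConditionC (μ : Measure X) (K g : ℝ → X → ℝ) : Prop :=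
  ∀ δ : ℝ, 0 < δ → ∃ C : X → ℝ, Measurable C ∧ (∀ τ, 0 ≤ C τ) ∧
    (∀ τ, ∀ u ∈ Icc 0 δ, g u τ ≤ C τ * u) ∧
    (∫⁻ τ, ENNReal.ofReal (C τ) * (∫⁻ s, ENNReal.ofReal (K s τ)) ∂μ) < ⊤

/-- Condition (P): a bounded solution `φ ≥ 0` vanishes at some point only if `φ ≡ 0`. -/
def ConditionP (μ : Measure X) (K g : ℝ → X → ℝ) : Prop :=
  ∀ φ : ℝ → ℝ, IsBoundedSolution μ K g φ → (∃ t, φ t = 0) → ∀ t, φ t = 0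

end ConvolutionDichotomy

end

/-!
# Dichotomy at infinity for bounded solutions

Let `φ` be a bounded solution. Its values are integrals of translates of the `L¹` function
`K(s, τ) C(τ)`, with `C` from condition (C), so continuity of translation in `L¹` makes `φ` uniformly
continuous. Hence every sequence of translates of `φ` has a subsequence converging pointwise to a
continuous function, which is again a bounded solution by dominated convergence. Combined with
condition (P) this compactness gives a Harnack-type bound: `φ(t) ≥ δ` forces `φ ≥ c` on
`[t - N, t + N]`, with `c > 0` depending on `δ` and `N` only
(`IsBoundedSolution.exists_pos_le_of_near`).

On the other hand, `χ(0) < 0` says that the kernel of the equation linearized at zero has mass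
greater than one. By Fatou's lemma, for some `n` a positive solution with values at most `1 / (n + 1)`
on `[t - n, t + n]` cannot attain its minimum over this interval at `t`
(`IsBoundedSolution.exists_not_le_near`).

The two facts together bound `φ` from below between any two points `a` and `b` at which `φ ≥ δ`
(`IsBoundedSolution.exists_pos_le_between`). A value of `φ` below `c` in between would lie in an
interval at whose endpoints `φ ≥ ε` and inside which `φ < ε`, for a fixed `ε`. The minimum of `φ` over
that interval would be attained further than `n` from its endpoints, which has just been
excluded. If `φ` does not tend to zero at `±∞`, then `φ ≥ δ` holds at points arbitrarily far out in that
direction, so the bound `φ ≥ c` is eventually true there.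
-/

namespace ConvolutionDichotomy

/-! ### Continuity of translation in `L¹` -/

theorem tendsto_integral_norm_translate_sub {f : ℝ → ℝ} (hf : Integrable f) :
    Tendsto (fun h => ∫ s, ‖f (s + h) - f s‖) (𝓝 0) (𝓝 0) := by
  let T (h : ℝ) : C(ℝ, ℝ) := ⟨(· + h), continuous_add_const h⟩
  have hT (h : ℝ) : MeasurePreserving (T h) volume volume := measurePreserving_add_right volume h
  have hTc : Tendsto T (𝓝 0) (𝓝 (T 0)) :=
    (ContinuousMap.continuous_of_continuous_uncurry T
      (continuous_snd.add continuous_fst)).tendsto 0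
  have hf' : MemLp f 1 := memLp_one_iff_integrable.2 hf
  have hlim := (tendsto_const_nhds (x := hf'.toLp f)).compMeasurePreservingLp hTc hT (hT 0)
    ENNReal.one_ne_top
  rw [tendsto_iff_dist_tendsto_zero] at hlim
  refine hlim.congr fun h => ?_
  rw [Lp.toLp_compMeasurePreserving, Lp.toLp_compMeasurePreserving, dist_eq_norm,
    ← MemLp.toLp_sub, L1.norm_eq_integral_norm]
  refine integral_congr_ae ?_
  filter_upwards [((hf'.comp_measurePreserving (hT h)).sub
    (hf'.comp_measurePreserving (hT 0))).coeFn_toLp] with s hs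
  rw [hs]
  simp [T]

variable {X : Type*} [MeasurableSpace X] {μ : Measure X} {K g : ℝ → X → ℝ} {φ : ℝ → ℝ}

/-- Only the real factor of the product is translated, so no topology on `X` is needed: the limit is
taken on each fibre and then integrated by dominated convergence. -/
theorem tendsto_integral_norm_translate_sub_prod [SFinite μ] {G : ℝ × X → ℝ}
    (hG : Integrable G (volume.prod μ)) :
    Tendsto (fun h => ∫ p : ℝ × X, ‖G (p.1 + h, p.2) - G p‖ ∂(volume.prod μ)) (𝓝 0) (𝓝 0) := by
  have hGh (h : ℝ) : Integrable (fun p : ℝ × X => G (p.1 + h, p.2)) (volume.prod μ) :=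
    ((measurePreserving_add_right volume h).prod
      (MeasurePreserving.id μ)).integrable_comp_of_integrable hG
  have hd (h : ℝ) := ((hGh h).sub hG).norm
  have heq : (fun h => ∫ p : ℝ × X, ‖G (p.1 + h, p.2) - G p‖ ∂(volume.prod μ)) =
      fun h => ∫ τ, (∫ s, ‖G (s + h, τ) - G (s, τ)‖) ∂μ :=
    funext fun h => integral_prod_symm _ (hd h)
  have h0 : ∫ _, (0 : ℝ) ∂μ = 0 := integral_zero X ℝ
  rw [heq]
  conv_rhs => rw [← h0]
  refine tendsto_integral_filter_of_dominated_convergence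
    (fun τ => (∫ s, ‖G (s, τ)‖) + ∫ s, ‖G (s, τ)‖)
    (Eventually.of_forall fun h => (hd h).integral_prod_right.aestronglyMeasurable)
    (Eventually.of_forall fun h => ?_)
    (hG.integral_norm_prod_right.add hG.integral_norm_prod_right) ?_
  · filter_upwards [hG.prod_left_ae] with τ hτ
    rw [Real.norm_of_nonneg (integral_nonneg fun _ => norm_nonneg _)]
    have hτ' : Integrable fun s => ‖G (s + h, τ)‖ := hτ.norm.comp_add_right h
    calc ∫ s, ‖G (s + h, τ) - G (s, τ)‖
        ≤ ∫ s, (‖G (s + h, τ)‖ + ‖G (s, τ)‖) :=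
          integral_mono ((hτ.comp_add_right h).sub hτ).norm (hτ'.add hτ.norm)
            fun s => norm_sub_le _ _
      _ = _ := by
          rw [integral_add hτ' hτ.norm, integral_add_right_eq_self (fun s => ‖G (s, τ)‖) h]
  · filter_upwards [hG.prod_left_ae] with τ hτ
    exact tendsto_integral_norm_translate_sub hτ

/-! ### Compactness of equicontinuous sequences -/

/-- A form of the Arzelà–Ascoli theorem: the subsequence is chosen to converge at rational points, and
equicontinuity carries the convergence over to all of `ℝ`. -/
theorem exists_subseq_tendsto_of_equicontinuous {F : ℕ → ℝ → ℝ} (hF : Equicontinuous F) {a b : ℝ}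
    (hab : ∀ n x, F n x ∈ Icc a b) :
    ∃ θ : ℕ → ℕ, StrictMono θ ∧ ∃ f : ℝ → ℝ, Continuous f ∧
      ∀ x, Tendsto (fun n => F (θ n) x) atTop (𝓝 (f x)) := by
  obtain ⟨r, -, θ, hθ, hr⟩ :=
    (isCompact_univ_pi fun _ : ℚ => isCompact_Icc (a := a) (b := b)).tendsto_subseq
      (x := fun n (q : ℚ) => F n q) fun n q _ => hab n q
  have hr' := fun q => (tendsto_pi_nhds.1 hr q).cauchySeq
  have hcauchy : ∀ x, CauchySeq fun n => F (θ n) x := by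
    intro x
    refine Metric.cauchySeq_iff'.2 fun ε hε => ?_
    obtain ⟨η, hη, hx⟩ := Metric.equicontinuousAt_iff.1 (hF x) (ε / 3) (by positivity)
    obtain ⟨q, hq⟩ := Rat.denseRange_cast.exists_dist_lt x hη
    obtain ⟨N, hN⟩ := Metric.cauchySeq_iff'.1 (hr' q) (ε / 3) (by positivity)
    refine ⟨N, fun n hn => ?_⟩
    have hq' : dist (q : ℝ) x < η := by rwa [dist_comm]
    have h1 := hx q hq' (θ n)
    have h2 := hx q hq' (θ N)
    have h3 := hN n hn
    simp only [Function.comp_apply] at h3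
    have h4 := dist_triangle4 (F (θ n) x) (F (θ n) q) (F (θ N) q) (F (θ N) x)
    rw [dist_comm (F (θ N) q)] at h4
    linarith
  choose f hf using fun x => cauchySeq_tendsto_of_complete (hcauchy x)
  refine ⟨θ, hθ, f, ?_, hf⟩
  exact (tendsto_pi_nhds.2 hf).continuous_of_equicontinuous (hF.comp θ)

/-! ### Regularity and compactness of bounded solutions -/

theorem ConditionC.exists_integrable [SFinite μ] (hC : ConditionC μ K g)
    (hKg : StandingAssumptions μ K g) {δ : ℝ} (hδ : 0 < δ) :
    ∃ C : X → ℝ, (∀ τ, 0 ≤ C τ) ∧ (∀ τ, ∀ u ∈ Icc 0 δ, g u τ ≤ C τ * u) ∧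
      Integrable (fun p : ℝ × X => K p.1 p.2 * C p.2) (volume.prod μ) := by
  obtain ⟨C, hCm, hC0, hCg, hCi⟩ := hC δ hδ
  have hK := hKg.kernel_integrable.aestronglyMeasurable
  have hm : AEStronglyMeasurable (fun p : ℝ × X => K p.1 p.2 * C p.2) (volume.prod μ) :=
    hK.mul (hCm.comp measurable_snd).aestronglyMeasurable
  refine ⟨C, hC0, hCg, hm, ?_⟩
  rw [hasFiniteIntegral_iff_ofReal
    (Eventually.of_forall fun p => mul_nonneg (hKg.kernel_nonneg _ _) (hC0 _)),
    lintegral_prod_symm _ hm.aemeasurable.ennreal_ofReal]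
  refine lt_of_eq_of_lt (lintegral_congr fun τ => ?_) hCi
  rw [← lintegral_const_mul' _ _ ENNReal.ofReal_ne_top]
  exact lintegral_congr fun s => by rw [mul_comm, ENNReal.ofReal_mul (hC0 τ)]

theorem IsBoundedSolution.eq_integral_prod [SFinite μ] (hφ : IsBoundedSolution μ K g φ) (t : ℝ) :
    φ t = ∫ p : ℝ × X, K p.1 p.2 * g (φ (t - p.1)) p.2 ∂(volume.prod μ) := by
  rw [hφ.equation t, integral_prod_symm _ (hφ.integrable t)]

theorem IsBoundedSolution.uniformContinuous [SFinite μ] (hφ : IsBoundedSolution μ K g φ)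
    (hKg : StandingAssumptions μ K g) (hC : ConditionC μ K g) : UniformContinuous φ := by
  obtain ⟨M, hM⟩ := hφ.bounded
  obtain ⟨D, hD0, hMD⟩ : ∃ D, 0 < D ∧ M ≤ D := ⟨max M 1, by positivity, le_max_left _ _⟩
  obtain ⟨C, hC0, hCg, hCi⟩ := hC.exists_integrable hKg hD0
  have hω := (tendsto_integral_norm_translate_sub_prod hCi).mul_const D
  rw [zero_mul] at hω
  have hmain : ∀ t h, |φ (t + h) - φ t| ≤ (∫ p : ℝ × X,
      ‖K (p.1 + h) p.2 * C p.2 - K p.1 p.2 * C p.2‖ ∂(volume.prod μ)) * D := by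
    intro t h
    have hmp : MeasurePreserving (Prod.map (· + h) id : ℝ × X → ℝ × X)
        (volume.prod μ) (volume.prod μ) :=
      (measurePreserving_add_right volume h).prod (MeasurePreserving.id μ)
    have hme : MeasurableEmbedding (Prod.map (· + h) id : ℝ × X → ℝ × X) :=
      ((MeasurableEquiv.addRight h).prodCongr (MeasurableEquiv.refl X)).measurableEmbedding
    have hrew (p : ℝ × X) : t + h - (p.1 + h) = t - p.1 := by ring
    -- Translating the integration variable moves the shift from the solution to the kernel.
    have hshift : φ (t + h) =
        ∫ p : ℝ × X, K (p.1 + h) p.2 * g (φ (t - p.1)) p.2 ∂(volume.prod μ) := by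
      rw [hφ.eq_integral_prod, ← hmp.integral_comp hme]
      simp only [Prod.map_fst, Prod.map_snd, id, hrew]
    have hint : Integrable
        (fun p : ℝ × X => K (p.1 + h) p.2 * g (φ (t - p.1)) p.2) (volume.prod μ) := by
      have := hmp.integrable_comp_of_integrable (hφ.integrable (t + h))
      simpa only [Function.comp_def, Prod.map_fst, Prod.map_snd, id, hrew] using this
    have hCi' : Integrable (fun p : ℝ × X => K (p.1 + h) p.2 * C p.2) (volume.prod μ) :=
      hmp.integrable_comp_of_integrable hCi
    rw [hshift, hφ.eq_integral_prod t, ← integral_sub hint (hφ.integrable t),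
      ← integral_mul_const, ← Real.norm_eq_abs]
    refine norm_integral_le_of_norm_le ((hCi'.sub hCi).norm.mul_const D)
      (Eventually.of_forall fun p => ?_)
    have hφ0 := hφ.nonneg (t - p.1)
    have hφD := (hM (t - p.1)).trans hMD
    rw [← sub_mul, ← sub_mul, norm_mul, norm_mul, mul_assoc, Real.norm_of_nonneg (hC0 _),
      Real.norm_of_nonneg (hKg.g_nonneg _ hφ0 _)]
    exact mul_le_mul_of_nonneg_left ((hCg _ _ ⟨hφ0, hφD⟩).trans
      (mul_le_mul_of_nonneg_left hφD (hC0 _))) (norm_nonneg _)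
  refine Metric.uniformContinuous_iff.2 fun ε hε => ?_
  obtain ⟨η, hη, hηε⟩ := Metric.eventually_nhds_iff.1 (hω.eventually_lt_const hε)
  refine ⟨η, hη, fun a b hab => ?_⟩
  have hab' := hηε (y := a - b) (by simpa [Real.dist_eq] using hab)
  have h1 := hmain b (a - b)
  rw [add_sub_cancel] at h1
  exact h1.trans_lt hab'

/-- A continuous pointwise limit of translates of a bounded solution is a bounded solution. -/
theorem IsBoundedSolution.of_tendsto_translates [SFinite μ] (hφ : IsBoundedSolution μ K g φ)
    (hKg : StandingAssumptions μ K g) (hC : ConditionC μ K g) {t : ℕ → ℝ} {f : ℝ → ℝ}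
    (hf : Continuous f) (hlim : ∀ x, Tendsto (fun n => φ (t n + x)) atTop (𝓝 (f x))) :
    IsBoundedSolution μ K g f := by
  obtain ⟨M, hM⟩ := hφ.bounded
  obtain ⟨D, hD0, hMD⟩ : ∃ D, 0 < D ∧ M ≤ D := ⟨max M 1, by positivity, le_max_left _ _⟩
  obtain ⟨C, hC0, hCg, hCi⟩ := hC.exists_integrable hKg hD0
  have hf0 : ∀ x, 0 ≤ f x := fun x => ge_of_tendsto' (hlim x) fun n => hφ.nonneg _
  have hfD : ∀ x, f x ≤ D := fun x => le_of_tendsto' (hlim x) fun n => (hM _).trans hMD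
  have hrew (x s : ℝ) (n : ℕ) : t n + x - s = t n + (x - s) := by ring
  have hptw : ∀ x, ∀ p : ℝ × X,
      Tendsto (fun n => K p.1 p.2 * g (φ (t n + x - p.1)) p.2) atTop
        (𝓝 (K p.1 p.2 * g (f (x - p.1)) p.2)) := by
    intro x p
    simp only [hrew]
    refine Tendsto.const_mul _ ((hKg.g_continuous p.2 _ (hf0 (x - p.1))).tendsto.comp ?_)
    exact tendsto_nhdsWithin_iff.2 ⟨hlim _, Eventually.of_forall fun n => hφ.nonneg _⟩
  have hbd : ∀ u, 0 ≤ u → u ≤ D → ∀ p : ℝ × X,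
      ‖K p.1 p.2 * g u p.2‖ ≤ K p.1 p.2 * C p.2 * D := by
    intro u hu0 huD p
    rw [Real.norm_of_nonneg (mul_nonneg (hKg.kernel_nonneg _ _) (hKg.g_nonneg _ hu0 _)), mul_assoc]
    exact mul_le_mul_of_nonneg_left ((hCg _ _ ⟨hu0, huD⟩).trans
      (mul_le_mul_of_nonneg_left huD (hC0 _))) (hKg.kernel_nonneg _ _)
  have hint : ∀ x, Integrable (fun p : ℝ × X => K p.1 p.2 * g (f (x - p.1)) p.2)
      (volume.prod μ) := fun x =>
    (hCi.mul_const D).mono'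
      (aestronglyMeasurable_of_tendsto_ae atTop
        (fun n => (hφ.integrable (t n + x)).aestronglyMeasurable)
        (Eventually.of_forall (hptw x)))
      (Eventually.of_forall fun p => hbd _ (hf0 _) (hfD _) p)
  refine ⟨hf.measurable.aemeasurable, hf0, ⟨D, hfD⟩, hint, fun x => ?_⟩
  rw [← integral_prod_symm _ (hint x)]
  refine tendsto_nhds_unique (hlim x) ?_
  simp only [hφ.eq_integral_prod (t _ + x)]
  exact tendsto_integral_of_dominated_convergence _
    (fun n => (hφ.integrable (t n + x)).aestronglyMeasurable) (hCi.mul_const D)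
    (fun n => Eventually.of_forall fun p => hbd _ (hφ.nonneg _) ((hM _).trans hMD) p)
    (Eventually.of_forall (hptw x))

/-! ### Lower bounds for positive solutions -/

/-- A Harnack-type bound: otherwise a limit of translates of `φ` would be a bounded solution that vanishes
at some point but not identically, contrary to condition (P). -/
theorem IsBoundedSolution.exists_pos_le_of_near [SFinite μ] (hφ : IsBoundedSolution μ K g φ)
    (hKg : StandingAssumptions μ K g) (hC : ConditionC μ K g) (hP : ConditionP μ K g)
    {δ : ℝ} (hδ : 0 < δ) (N : ℝ) :
    ∃ c, 0 < c ∧ ∀ t, δ ≤ φ t → ∀ s, |s| ≤ N → c ≤ φ (t + s) := by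
  by_contra! hcon
  choose t ht s hs hts using fun n : ℕ => hcon (1 / ((n : ℝ) + 1)) Nat.one_div_pos_of_nat
  obtain ⟨s₀, -, α, hα, hsα⟩ := (isCompact_Icc (a := -N) (b := N)).tendsto_subseq
    fun n => abs_le.1 (hs n)
  have huc := hφ.uniformContinuous hKg hC
  obtain ⟨M, hM⟩ := hφ.bounded
  have hequi : Equicontinuous fun (n : ℕ) x => φ (t (α n) + x) := by
    refine UniformEquicontinuous.equicontinuous (Metric.uniformEquicontinuous_iff.2 fun ε hε => ?_)
    obtain ⟨η, hη, h⟩ := Metric.uniformContinuous_iff.1 huc ε hε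
    exact ⟨η, hη, fun x y hxy n => h (by rwa [dist_add_left])⟩
  obtain ⟨θ, hθ, f, hf, hlim⟩ := exists_subseq_tendsto_of_equicontinuous hequi (a := 0) (b := M)
    fun n x => ⟨hφ.nonneg _, hM _⟩
  have hfsol := hφ.of_tendsto_translates hKg hC hf hlim
  -- The limit vanishes at the limit of the shifts, although it is at least `δ` at the origin.
  have hs₀ : f s₀ = 0 := by
    have h1 : Tendsto (fun n => φ (t (α (θ n)) + s (α (θ n)))) atTop (𝓝 (f s₀)) := by
      have h0 : Tendsto (fun n => dist (φ (t (α (θ n)) + s₀)) (φ (t (α (θ n)) + s (α (θ n)))))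
          atTop (𝓝 0) := by
        refine Metric.tendsto_nhds.2 fun ε hε => ?_
        obtain ⟨η, hη, h⟩ := Metric.uniformContinuous_iff.1 huc ε hε
        filter_upwards [Metric.tendsto_nhds.1 (hsα.comp hθ.tendsto_atTop) η hη] with n hn
        rw [Real.dist_0_eq_abs, abs_of_nonneg dist_nonneg]
        refine h ?_
        rwa [dist_add_left, dist_comm]
      exact (tendsto_iff_of_dist h0).1 (hlim s₀)
    have h2 : Tendsto (fun n => φ (t (α (θ n)) + s (α (θ n)))) atTop (𝓝 0) :=
      squeeze_zero (fun n => hφ.nonneg _) (fun n => (hts _).le)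
        (tendsto_one_div_add_atTop_nhds_zero_nat.comp (hα.comp hθ).tendsto_atTop)
    exact tendsto_nhds_unique h1 h2
  have h0 := hP f hfsol ⟨s₀, hs₀⟩ 0
  have hδ0 : δ ≤ f 0 := ge_of_tendsto' (hlim 0) fun n => by simpa using ht (α (θ n))
  linarith

theorem one_lt_lintegral_of_chi_neg (hchi : chi μ K g 0 < 0) :
    1 < ∫⁻ τ, (∫⁻ s, ENNReal.ofReal
      (K s τ * derivWithin (fun u => g u τ) (Ici 0) 0)) ∂μ := by
  have h := (EReal.sub_neg (by left; decide) (by left; decide)).1 hchi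
  refine EReal.coe_ennreal_lt_coe_ennreal_iff.1 ?_
  simpa using h

/-- No point is a minimum of `φ` over a window of fixed size about it on which `φ` is small. With
`φ (t n) ≤ φ (t n - s) → 0` on windows growing with `n`, the equation divided by `φ (t n)` yields
`∫ K(s, τ) g(φ(t n - s), τ) / φ(t n - s) ≤ 1` over the windows, and Fatou's lemma would give
`∫ K(s, τ) g'(0, τ) ≤ 1`. -/
theorem IsBoundedSolution.exists_not_le_near [SFinite μ] (hφ : IsBoundedSolution μ K g φ)
    (hKg : StandingAssumptions μ K g) (hcont : Continuous φ) (hpos : ∀ t, 0 < φ t)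
    (hchi : chi μ K g 0 < 0) :
    ∃ n : ℕ, ∀ t, ¬ ∀ s : ℝ, |s| ≤ n → φ t ≤ φ (t - s) ∧ φ (t - s) ≤ 1 / ((n : ℝ) + 1) := by
  by_contra! hcon
  choose t ht using hcon
  refine (one_lt_lintegral_of_chi_neg hchi).not_ge ?_
  set H : ℕ → ℝ × X → ENNReal := fun n =>
    {p : ℝ × X | |p.1| ≤ n}.indicator fun p =>
      ENNReal.ofReal (K p.1 p.2 * g (φ (t n - p.1)) p.2 / φ (t n - p.1)) with hH
  have hHm : ∀ n, AEMeasurable (H n) (volume.prod μ) := fun n => by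
    refine AEMeasurable.indicator (AEMeasurable.ennreal_ofReal
      ((hφ.integrable (t n)).aemeasurable.div
        (Measurable.aemeasurable (by fun_prop)))) ?_
    exact measurableSet_le (by fun_prop) measurable_const
  have hHle : ∀ n, ∫⁻ p, H n p ∂(volume.prod μ) ≤ 1 := fun n => by
    have h0 : ∀ p : ℝ × X, 0 ≤ K p.1 p.2 * g (φ (t n - p.1)) p.2 := fun p =>
      mul_nonneg (hKg.kernel_nonneg _ _) (hKg.g_nonneg _ (hφ.nonneg _) _)
    calc ∫⁻ p, H n p ∂(volume.prod μ)
        ≤ ∫⁻ p : ℝ × X, ENNReal.ofReal (K p.1 p.2 * g (φ (t n - p.1)) p.2 / φ (t n))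
            ∂(volume.prod μ) := by
          refine lintegral_mono (indicator_le' (fun q hq => ?_) (fun _ _ => zero_le))
          exact ENNReal.ofReal_le_ofReal
            (div_le_div_of_nonneg_left (h0 q) (hpos _) (ht n q.1 hq).1)
      _ = ENNReal.ofReal (φ (t n) / φ (t n)) := by
          rw [← ofReal_integral_eq_lintegral_ofReal ((hφ.integrable (t n)).div_const _)
            (Eventually.of_forall fun p => div_nonneg (h0 p) (hpos _).le), integral_div,
            ← hφ.eq_integral_prod]
      _ = 1 := by rw [div_self (hpos _).ne', ENNReal.ofReal_one]
  have hHlim : ∀ p : ℝ × X, Tendsto (fun n => H n p) atTop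
      (𝓝 (ENNReal.ofReal (K p.1 p.2 * derivWithin (fun u => g u p.2) (Ici 0) 0))) := by
    intro p
    obtain ⟨n₀, hn₀⟩ := exists_nat_ge |p.1|
    have hev : ∀ᶠ n : ℕ in atTop, |p.1| ≤ n :=
      (eventually_ge_atTop n₀).mono fun n hn => hn₀.trans (Nat.cast_le.2 hn)
    have hu : Tendsto (fun n => φ (t n - p.1)) atTop (𝓝[Ici 0 \ {0}] 0) := by
      refine tendsto_nhdsWithin_iff.2 ⟨?_, Eventually.of_forall fun n =>
        ⟨hφ.nonneg _, (hpos _).ne'⟩⟩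
      exact squeeze_zero' (Eventually.of_forall fun n => hφ.nonneg _)
        (hev.mono fun n hn => (ht n p.1 hn).2) tendsto_one_div_add_atTop_nhds_zero_nat
    have hslope := (hasDerivWithinAt_iff_tendsto_slope.1
      (hKg.g_differentiable p.2).hasDerivWithinAt).comp hu
    refine (ENNReal.tendsto_ofReal (hslope.const_mul (K p.1 p.2))).congr' ?_
    filter_upwards [hev] with n hn
    simp only [hH]
    rw [indicator_of_mem (show p ∈ {p : ℝ × X | |p.1| ≤ n} from hn)]
    simp [slope_def_field, hKg.g_zero, mul_div_assoc]
  -- The limit inherits measurability from the sequence, so the iterated integral is a double one.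
  have hm := aemeasurable_of_tendsto_metrizable_ae atTop hHm (Eventually.of_forall hHlim)
  rw [← lintegral_prod_symm _ hm]
  calc _ = ∫⁻ p, liminf (fun n => H n p) atTop ∂(volume.prod μ) :=
        lintegral_congr fun p => (hHlim p).liminf_eq.symm
    _ ≤ liminf (fun n => ∫⁻ p, H n p ∂(volume.prod μ)) atTop := lintegral_liminf_le' hHm
    _ ≤ 1 := liminf_le_of_le (by isBoundedDefault) fun b hb => by
        obtain ⟨n, hn⟩ := hb.exists
        exact hn.trans (hHle n)

/-- The constant `c` does not depend on `a` and `b`, however far apart they are. -/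
theorem IsBoundedSolution.exists_pos_le_between [SFinite μ] (hφ : IsBoundedSolution μ K g φ)
    (hKg : StandingAssumptions μ K g) (hC : ConditionC μ K g) (hP : ConditionP μ K g)
    (hchi : chi μ K g 0 < 0) (hpos : ∀ t, 0 < φ t) {δ : ℝ} (hδ : 0 < δ) :
    ∃ c, 0 < c ∧ ∀ a b, δ ≤ φ a → δ ≤ φ b → ∀ t ∈ Icc a b, c ≤ φ t := by
  have hcont := (hφ.uniformContinuous hKg hC).continuous
  obtain ⟨n, hn⟩ := hφ.exists_not_le_near hKg hcont hpos hchi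
  set ε := min δ (1 / ((n : ℝ) + 1)) with hε
  have hε0 : 0 < ε := lt_min hδ Nat.one_div_pos_of_nat
  obtain ⟨c, hc0, hc⟩ := hφ.exists_pos_le_of_near hKg hC hP hε0 n
  refine ⟨c, hc0, fun a₀ b₀ ha₀ hb₀ t ht => ?_⟩
  by_contra! htc
  have hclosed : IsClosed {x | ε ≤ φ x} := isClosed_le continuous_const hcont
  -- `a` and `b` are the points nearest to `t` on either side at which `φ` reaches `ε`.
  obtain ⟨a, ⟨⟨ha₀a, hat⟩, haε⟩, ha⟩ := (isCompact_Icc.inter_right hclosed).exists_isGreatest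
    (⟨a₀, ⟨le_rfl, ht.1⟩, (min_le_left _ _).trans ha₀⟩ : (Icc a₀ t ∩ {x | ε ≤ φ x}).Nonempty)
  obtain ⟨b, ⟨⟨htb, hbb₀⟩, hbε⟩, hb⟩ := (isCompact_Icc.inter_right hclosed).exists_isLeast
    (⟨b₀, ⟨ht.2, le_rfl⟩, (min_le_left _ _).trans hb₀⟩ : (Icc t b₀ ∩ {x | ε ≤ φ x}).Nonempty)
  have hlt : ∀ x ∈ Ioo a b, φ x < ε := by
    intro x hx
    by_contra! hxε
    rcases le_total x t with hxt | hxt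
    · exact hx.1.not_ge (ha ⟨⟨ha₀a.trans hx.1.le, hxt⟩, hxε⟩)
    · exact hx.2.not_ge (hb ⟨⟨hxt, hx.2.le.trans hbb₀⟩, hxε⟩)
  obtain ⟨m, ⟨ham, hmb⟩, hm⟩ := isCompact_Icc.exists_isMinOn ⟨t, hat, htb⟩ hcont.continuousOn
  have hmc : φ m < c := (hm ⟨hat, htb⟩).trans_lt htc
  -- The values of `φ` within distance `n` of `a` and `b` exceed `c`, so `m` is not there.
  have ham' : a + n < m := by
    by_contra! h
    refine hmc.not_ge ?_
    simpa using hc a haε (m - a) (abs_le.2 ⟨by linarith, by linarith⟩)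
  have hmb' : m < b - n := by
    by_contra! h
    refine hmc.not_ge ?_
    simpa using hc b hbε (m - b) (abs_le.2 ⟨by linarith, by linarith⟩)
  refine hn m fun s hs => ?_
  have hs' := abs_le.1 hs
  have hI : m - s ∈ Ioo a b := ⟨by linarith, by linarith⟩
  exact ⟨hm (Ioo_subset_Icc_self hI), (hlt _ hI).le.trans (min_le_right _ _)⟩

/-! ### The dichotomy -/

/-- The dichotomy along any filter `l`, provided that `φ` is eventually bounded away from zero as soon as
it is so frequently. -/
theorem IsBoundedSolution.dichotomy [SFinite μ] (hφ : IsBoundedSolution μ K g φ)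
    {l : Filter ℝ} [l.NeBot]
    (h : ∀ δ, 0 < δ → (∃ᶠ t in l, δ ≤ φ t) → ∃ c, 0 < c ∧ ∀ᶠ t in l, c ≤ φ t) :
    Xor (0 < liminf φ l) (Tendsto φ l (𝓝 0)) := by
  obtain ⟨M, hM⟩ := hφ.bounded
  by_cases hlim : Tendsto φ l (𝓝 0)
  · exact Or.inr ⟨hlim, by rw [hlim.liminf_eq]; exact lt_irrefl 0⟩
  · refine Or.inl ⟨?_, hlim⟩
    obtain ⟨δ, hδ, hfr⟩ : ∃ δ, 0 < δ ∧ ∃ᶠ t in l, δ ≤ φ t := by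
      contrapose! hlim
      refine Metric.tendsto_nhds.2 fun ε hε => ?_
      filter_upwards [hlim ε hε] with t ht
      rw [Real.dist_eq, sub_zero, abs_of_nonneg (hφ.nonneg t)]
      exact ht
    obtain ⟨c, hc, hev⟩ := h δ hδ hfr
    refine hc.trans_le (le_liminf_of_le ?_ hev)
    exact (isBoundedUnder_of ⟨M, hM⟩ : IsBoundedUnder (· ≤ ·) l φ).isCoboundedUnder_ge

end ConvolutionDichotomy

theorem mainTheorem1 {X : Type*} [MeasurableSpace X] (μ : Measure X) [IsFiniteMeasure μ]
    (K g : ℝ → X → ℝ)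
    (hKg : ConvolutionDichotomy.StandingAssumptions μ K g)
    (hC : ConvolutionDichotomy.ConditionC μ K g)
    (hP : ConvolutionDichotomy.ConditionP μ K g)
    (hchi : ConvolutionDichotomy.chi μ K g 0 < 0)
    (φ : ℝ → ℝ) (hφ : ConvolutionDichotomy.IsBoundedSolution μ K g φ) :
    Xor (0 < liminf φ atTop) (Tendsto φ atTop (𝓝 0)) ∧
      Xor (0 < liminf φ atBot) (Tendsto φ atBot (𝓝 0)) := by
  by_cases hz : ∃ t, φ t = 0
  · have h0 := hP φ hφ hz
    constructor <;> refine hφ.dichotomy fun δ hδ hfr => ?_ <;>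
    · obtain ⟨t, ht⟩ := hfr.exists
      exact absurd (h0 t) (hδ.trans_le ht).ne'
  push Not at hz
  have hpos : ∀ t, 0 < φ t := fun t => (hφ.nonneg t).lt_of_ne' (hz t)
  constructor <;> refine hφ.dichotomy fun δ hδ hfr => ?_ <;>
    obtain ⟨c, hc, hcφ⟩ := hφ.exists_pos_le_between hKg hC hP hchi hpos hδ <;>
    obtain ⟨a, ha⟩ := hfr.exists <;>
    refine ⟨c, hc, ?_⟩
  · filter_upwards [eventually_ge_atTop a] with t ht
    obtain ⟨b, hb, htb⟩ := (hfr.and_eventually (eventually_ge_atTop t)).exists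
    exact hcφ a b ha hb t ⟨ht, htb⟩
  · filter_upwards [eventually_le_atBot a] with t ht
    obtain ⟨b, hb, hbt⟩ := (hfr.and_eventually (eventually_le_atBot t)).exists
    exact hcφ b a hb ha t ⟨hbt, ht⟩
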